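/- Let $1<p<\infty$, let $m,n$ be natural numbers, and let $A,B$ be complex $m\times n$ matrices. Suppose that $A=DC$, where $D$ is a positive (that is, positive semidefinite Hermitian) $m\times m$ complex matrix and $C$ is an $m\times n$ complex matrix with $CC^*=I_m$. For a complex matrix $X$ with $k$ columns let $\|X\|_p=\big(\sum_{i=1}^{k}s_i(X)^p\big)^{1/p}$ be its Schatten $p$-norm, where $s_1(X)\ge\dots\ge s_k(X)\ge 0$ are the singular values of $X$, i.e. the square roots of the eigenvalues of $X^*X$ counted with multiplicity. Then $A$ is norm-parallel to $B$ in $\|\cdot\|_p$, that is, $\|A+\lambda B\|_p=\|A\|_p+\|B\|_p$ for some $\lambda\in\mathbb{C}$ with $|\lambda|=1$, if and only if $$\big|\operatorname{tr}(D^{p-1}CB^*)\big|=\frac{\|B\|_p\,\|D\|_p^p}{\|A\|_p}$$ (for $A=0$, where $D=0$ as well, the right-hand side is read as $0$). -/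

import Mathlib

open scoped Matrix ComplexOrder MatrixOrder

/-- The Schatten `p`-norm `(∑ᵢ sᵢ(A) ^ p) ^ (1 / p)` of a complex `m × n` matrix (for real `p ≥ 1`),
where `s₁(A) ≥ ⋯ ≥ sₙ(A)` are the singular values of `A`, i.e. the square roots of the eigenvalues
of `Aᴴ * A`, counted with multiplicity. Mathlib numbers the singular values from `0`. -/
noncomputable def schattenNorm {m n : ℕ} (p : ℝ) (A : Matrix (Fin m) (Fin n) ℂ) : ℝ :=
  (∑ i : Fin n, (Matrix.toEuclideanLin A).singularValues i ^ p) ^ (1 / p)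

/-- `x` is norm-parallel to `y` with respect to `ν`: `ν (x + c y) = ν x + ν y` for some complex
number `c` of modulus one. -/
def NormParallel {E : Type*} [AddCommGroup E] [Module ℂ E] (ν : E → ℝ) (x y : E) : Prop :=
  ∃ c : ℂ, ‖c‖ = 1 ∧ ν (x + c • y) = ν x + ν y

/-!
The Schatten norm is smooth for `1 < p`: a matrix `X` has, up to a scalar, a single norming
functional, represented through the pairing `tr (Yᴴ X)` by a matrix `Y` measured in the `q`-norm,
where `q` is the conjugate exponent. With `X = U diag(s) Vᴴ` a singular value decomposition, the
representative with `‖Y‖_q ^ q = ‖X‖_p ^ p` is `Y = U diag(s ^ (p - 1)) Vᴴ` (`IsDual`,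
`IsDual.unique`). In a smooth norm, `‖X + c Y‖ = ‖X‖ + ‖Y‖` for some unimodular `c` exactly when the
norming functional of `X` attains its norm at `Y` (`IsDual.normParallel_iff`): a norming functional
of `X + c Y` norms `X` and `c Y`, hence is that of `X`; the converse rotates `Y` by the phase of the
pairing.

For `A = D C` with spectral decomposition `D = E diag(d) Eᴴ`, the factorization
`A = E diag(d) (Cᴴ E)ᴴ` is a singular value decomposition, since `C Cᴴ = 1`. So `‖A‖_p = ‖D‖_p`, the
norming functional of `A` is represented by `D ^ (p - 1) C`, and its `q`-norm is `‖D‖_p ^ (p - 1)`.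

Hölder's inequality and its equality case rest on one computation. For decompositions
`X = ∑ sᵢ uᵢ vᵢᴴ` and `Y = ∑ tⱼ wⱼ qⱼᴴ`, the real part of `tr (Yᴴ X)` is the sum of the
`sᵢ tⱼ Re (⟨wⱼ, uᵢ⟩ ⟨vᵢ, qⱼ⟩)`, which is at most the sum of the `sᵢ tⱼ mᵢⱼ` with the doubly
substochastic matrix `mᵢⱼ = (|⟨wⱼ, uᵢ⟩|² + |⟨vᵢ, qⱼ⟩|²) / 2` (`overlap`). The scalar Young inequality
then bounds it by `∑ sᵢ ^ p / p + ∑ tⱼ ^ q / q` (`IsSVD.re_trace_le`), and equality forces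
`Y = U diag(s ^ (p - 1)) Vᴴ` (`IsSVD.eq_of_re_trace_eq`). The same inequality shows that the Schatten
norm can be computed from any singular value decomposition (`IsSVD.schattenNorm_rpow`).
-/

/-- `X = U * diagonal s * Vᴴ` is a singular value decomposition of `X` in compact form: the columns
of `U` and those of `V` are orthonormal families with a common index type, not necessarily bases.
The `s i` may vanish and come in no particular order. -/
structure IsSVD {m n : ℕ} {ι : Type*} [Fintype ι] [DecidableEq ι]
    (X : Matrix (Fin m) (Fin n) ℂ) (U : Matrix (Fin m) ι ℂ) (s : ι → ℝ)
    (V : Matrix (Fin n) ι ℂ) : Prop where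
  left_orthonormal : Uᴴ * U = 1
  right_orthonormal : Vᴴ * V = 1
  nonneg : ∀ i, 0 ≤ s i
  eq : X = U * Matrix.diagonal (fun i => (s i : ℂ)) * Vᴴ

/-! ### Overlaps of two orthonormal systems -/

section overlap

variable {m n : ℕ} {ι κ : Type*}

/-- The mean of the squared overlaps `|⟨wⱼ, uᵢ⟩|²` and `|⟨vᵢ, qⱼ⟩|²` of the columns of `U` with those
of `W` and of the columns of `V` with those of `Q`. For orthonormal columns this is a doubly
substochastic matrix. -/
noncomputable def overlap (U : Matrix (Fin m) ι ℂ) (V : Matrix (Fin n) ι ℂ)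
    (W : Matrix (Fin m) κ ℂ) (Q : Matrix (Fin n) κ ℂ) (i : ι) (j : κ) : ℝ :=
  (‖(Wᴴ * U) j i‖ ^ 2 + ‖(Vᴴ * Q) i j‖ ^ 2) / 2

variable {U : Matrix (Fin m) ι ℂ} {V : Matrix (Fin n) ι ℂ}
  {W : Matrix (Fin m) κ ℂ} {Q : Matrix (Fin n) κ ℂ}

theorem overlap_nonneg (i : ι) (j : κ) : 0 ≤ overlap U V W Q i j := by
  unfold overlap; positivity

theorem norm_conjTranspose_mul_comm (U : Matrix (Fin m) ι ℂ) (W : Matrix (Fin m) κ ℂ)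
    (i : ι) (j : κ) : ‖(Uᴴ * W) i j‖ = ‖(Wᴴ * U) j i‖ := by
  rw [← norm_star ((Wᴴ * U) j i), ← Matrix.conjTranspose_apply, Matrix.conjTranspose_mul,
    Matrix.conjTranspose_conjTranspose]

theorem re_mul_le_overlap (i : ι) (j : κ) :
    ((Wᴴ * U) j i * (Vᴴ * Q) i j).re ≤ overlap U V W Q i j := by
  refine (Complex.re_le_norm _).trans ?_
  rw [norm_mul, overlap]
  nlinarith [sq_nonneg (‖(Wᴴ * U) j i‖ - ‖(Vᴴ * Q) i j‖)]

variable [Fintype ι] [DecidableEq ι] [Fintype κ] [DecidableEq κ]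

/-- Bessel's inequality, for the expansion of a column of `U` in the columns of `W`. -/
theorem sum_norm_sq_conjTranspose_mul_le_one {U : Matrix (Fin m) ι ℂ} {W : Matrix (Fin m) κ ℂ}
    (hU : Uᴴ * U = 1) (hW : Wᴴ * W = 1) (i : ι) : ∑ j, ‖(Wᴴ * U) j i‖ ^ 2 ≤ 1 := by
  -- the Gram matrix of the components of the columns of `U` orthogonal to the columns of `W`
  have h1 : (U - W * (Wᴴ * U))ᴴ * (U - W * (Wᴴ * U)) = 1 - (Wᴴ * U)ᴴ * (Wᴴ * U) := by
    have e : Wᴴ * (W * (Wᴴ * U)) = Wᴴ * U := by rw [← Matrix.mul_assoc, hW, Matrix.one_mul]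
    simp only [Matrix.conjTranspose_sub, Matrix.conjTranspose_mul,
      Matrix.conjTranspose_conjTranspose, Matrix.sub_mul, Matrix.mul_sub, Matrix.mul_assoc, hU, e]
    abel
  have h2 := (Matrix.posSemidef_conjTranspose_mul_self (U - W * (Wᴴ * U))).diag_nonneg (i := i)
  rw [h1, Matrix.sub_apply, Matrix.one_apply_eq, Matrix.mul_apply] at h2
  have h3 : ∑ j, (Wᴴ * U)ᴴ i j * (Wᴴ * U) j i = ((∑ j, ‖(Wᴴ * U) j i‖ ^ 2 : ℝ) : ℂ) := by
    push_cast
    refine Finset.sum_congr rfl fun j _ => ?_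
    exact Complex.conj_mul' _
  rw [h3] at h2
  have h4 : (0 : ℂ) ≤ ((1 - ∑ j, ‖(Wᴴ * U) j i‖ ^ 2 : ℝ) : ℂ) := by push_cast at h2 ⊢; exact h2
  linarith [Complex.zero_le_real.mp h4]

theorem sum_overlap_right_le_one (hU : Uᴴ * U = 1) (hV : Vᴴ * V = 1) (hW : Wᴴ * W = 1)
    (hQ : Qᴴ * Q = 1) (i : ι) : ∑ j, overlap U V W Q i j ≤ 1 := by
  have h1 := sum_norm_sq_conjTranspose_mul_le_one hU hW i
  have h2 := sum_norm_sq_conjTranspose_mul_le_one hV hQ i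
  simp only [overlap, norm_conjTranspose_mul_comm V Q, ← Finset.sum_div, Finset.sum_add_distrib]
  linarith

theorem sum_overlap_left_le_one (hU : Uᴴ * U = 1) (hV : Vᴴ * V = 1) (hW : Wᴴ * W = 1)
    (hQ : Qᴴ * Q = 1) (j : κ) : ∑ i, overlap U V W Q i j ≤ 1 := by
  have h1 := sum_norm_sq_conjTranspose_mul_le_one hW hU j
  have h2 := sum_norm_sq_conjTranspose_mul_le_one hQ hV j
  simp only [overlap, norm_conjTranspose_mul_comm W U, ← Finset.sum_div, Finset.sum_add_distrib]
  linarith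

theorem trace_conjTranspose_mul_diagonal (U : Matrix (Fin m) ι ℂ) (V : Matrix (Fin n) ι ℂ)
    (W : Matrix (Fin m) κ ℂ) (Q : Matrix (Fin n) κ ℂ) (s : ι → ℝ) (t : κ → ℝ) :
    ((W * Matrix.diagonal (fun j => (t j : ℂ)) * Qᴴ)ᴴ *
      (U * Matrix.diagonal (fun i => (s i : ℂ)) * Vᴴ)).trace.re =
      ∑ i, ∑ j, s i * t j * ((Wᴴ * U) j i * (Vᴴ * Q) i j).re := by
  have h : ((W * Matrix.diagonal (fun j => (t j : ℂ)) * Qᴴ)ᴴ *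
      (U * Matrix.diagonal (fun i => (s i : ℂ)) * Vᴴ)).trace =
      ((Vᴴ * Q) * Matrix.diagonal (fun j => (t j : ℂ)) *
        ((Wᴴ * U) * Matrix.diagonal (fun i => (s i : ℂ)))).trace := by
    have hd : (Matrix.diagonal (fun j => (t j : ℂ)))ᴴ = Matrix.diagonal (fun j => (t j : ℂ)) := by
      rw [Matrix.diagonal_conjTranspose]
      congr 1
      ext j
      simp
    rw [← Matrix.mul_assoc, Matrix.trace_mul_comm]
    simp only [Matrix.conjTranspose_mul, Matrix.conjTranspose_conjTranspose, hd, Matrix.mul_assoc]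
  rw [h, Matrix.trace, Complex.re_sum]
  refine Finset.sum_congr rfl fun i _ => ?_
  rw [Matrix.diag_apply, Matrix.mul_apply, Complex.re_sum]
  refine Finset.sum_congr rfl fun j _ => ?_
  rw [Matrix.mul_diagonal, Matrix.mul_diagonal,
    show (Vᴴ * Q) i j * (t j : ℂ) * ((Wᴴ * U) j i * (s i : ℂ)) =
      ((s i * t j : ℝ) : ℂ) * ((Wᴴ * U) j i * (Vᴴ * Q) i j) by push_cast; ring,
    Complex.re_ofReal_mul]

end overlap

/-! ### Young's inequality for the trace pairing, and its equality case -/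

namespace IsSVD

variable {m n : ℕ} {ι κ : Type*} [Fintype ι] [DecidableEq ι] [Fintype κ] [DecidableEq κ]
  {X Y : Matrix (Fin m) (Fin n) ℂ} {U : Matrix (Fin m) ι ℂ} {V : Matrix (Fin n) ι ℂ}
  {W : Matrix (Fin m) κ ℂ} {Q : Matrix (Fin n) κ ℂ} {s : ι → ℝ} {t : κ → ℝ}
  {p q : ℝ}

theorem sum_mul_overlap_le (hX : IsSVD X U s V) (hY : IsSVD Y W t Q) {f : ι → ℝ}
    (hf : ∀ i, 0 ≤ f i) : ∑ i, ∑ j, f i * overlap U V W Q i j ≤ ∑ i, f i := by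
  refine Finset.sum_le_sum fun i _ => ?_
  rw [← Finset.mul_sum]
  exact mul_le_of_le_one_right (hf i) (sum_overlap_right_le_one hX.left_orthonormal
    hX.right_orthonormal hY.left_orthonormal hY.right_orthonormal i)

theorem sum_mul_overlap_le' (hX : IsSVD X U s V) (hY : IsSVD Y W t Q) {g : κ → ℝ}
    (hg : ∀ j, 0 ≤ g j) : ∑ i, ∑ j, g j * overlap U V W Q i j ≤ ∑ j, g j := by
  rw [Finset.sum_comm]
  refine Finset.sum_le_sum fun j _ => ?_
  rw [← Finset.mul_sum]
  exact mul_le_of_le_one_right (hg j) (sum_overlap_left_le_one hX.left_orthonormal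
    hX.right_orthonormal hY.left_orthonormal hY.right_orthonormal j)

theorem re_trace_eq (hX : IsSVD X U s V) (hY : IsSVD Y W t Q) :
    (Yᴴ * X).trace.re = ∑ i, ∑ j, s i * t j * ((Wᴴ * U) j i * (Vᴴ * Q) i j).re := by
  conv_lhs => rw [hX.eq, hY.eq]
  exact trace_conjTranspose_mul_diagonal U V W Q s t

theorem term_le_overlap (hX : IsSVD X U s V) (hY : IsSVD Y W t Q) (i : ι) (j : κ) :
    s i * t j * ((Wᴴ * U) j i * (Vᴴ * Q) i j).re ≤ s i * t j * overlap U V W Q i j :=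
  mul_le_mul_of_nonneg_left (re_mul_le_overlap i j) (mul_nonneg (hX.nonneg i) (hY.nonneg j))

theorem mul_overlap_le (hX : IsSVD X U s V) (hY : IsSVD Y W t Q) (hpq : p.HolderConjugate q)
    (i : ι) (j : κ) :
    s i * t j * overlap U V W Q i j ≤ (s i ^ p / p + t j ^ q / q) * overlap U V W Q i j :=
  mul_le_mul_of_nonneg_right (Real.young_inequality_of_nonneg (hX.nonneg i) (hY.nonneg j) hpq)
    (overlap_nonneg i j)

theorem rpow_div_nonneg (hX : IsSVD X U s V) (hp : 0 < p) (i : ι) : 0 ≤ s i ^ p / p :=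
  div_nonneg (Real.rpow_nonneg (hX.nonneg i) _) hp.le

/-- Young's inequality for the trace pairing: the scalar inequality, averaged with the overlaps. -/
theorem re_trace_le (hX : IsSVD X U s V) (hY : IsSVD Y W t Q) (hpq : p.HolderConjugate q) :
    (Yᴴ * X).trace.re ≤ (∑ i, s i ^ p) / p + (∑ j, t j ^ q) / q := by
  rw [hX.re_trace_eq hY, Finset.sum_div, Finset.sum_div]
  calc _ ≤ ∑ i, ∑ j, (s i ^ p / p + t j ^ q / q) * overlap U V W Q i j :=
        Finset.sum_le_sum fun i _ => Finset.sum_le_sum fun j _ =>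
          (hX.term_le_overlap hY i j).trans (hX.mul_overlap_le hY hpq i j)
    _ = (∑ i, ∑ j, s i ^ p / p * overlap U V W Q i j) +
        ∑ i, ∑ j, t j ^ q / q * overlap U V W Q i j := by
        simp only [add_mul, Finset.sum_add_distrib]
    _ ≤ _ := add_le_add (hX.sum_mul_overlap_le hY (hX.rpow_div_nonneg hpq.pos))
        (hX.sum_mul_overlap_le' hY (hY.rpow_div_nonneg hpq.symm.pos))

/-- Equality in `IsSVD.re_trace_le` forces equality, term by term, in each of the estimates that
lead to it. -/
theorem overlap_of_re_trace_eq (hX : IsSVD X U s V) (hY : IsSVD Y W t Q)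
    (hpq : p.HolderConjugate q)
    (h : (Yᴴ * X).trace.re = (∑ i, s i ^ p) / p + (∑ j, t j ^ q) / q) :
    (∀ i j, s i * t j * ((Wᴴ * U) j i * (Vᴴ * Q) i j).re = s i * t j * overlap U V W Q i j) ∧
    (∀ i j, overlap U V W Q i j ≠ 0 → s i ^ p = t j ^ q) ∧
    (∀ i, s i ≠ 0 → ∑ j, overlap U V W Q i j = 1) ∧
    (∀ j, t j ≠ 0 → ∑ i, overlap U V W Q i j = 1) := by
  rw [hX.re_trace_eq hY, Finset.sum_div, Finset.sum_div] at h
  have h1 : ∀ i ∈ Finset.univ, ∑ j, s i * t j * ((Wᴴ * U) j i * (Vᴴ * Q) i j).re ≤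
      ∑ j, s i * t j * overlap U V W Q i j :=
    fun i _ => Finset.sum_le_sum fun j _ => hX.term_le_overlap hY i j
  have h2 : ∀ i ∈ Finset.univ, ∑ j, s i * t j * overlap U V W Q i j ≤
      ∑ j, (s i ^ p / p + t j ^ q / q) * overlap U V W Q i j :=
    fun i _ => Finset.sum_le_sum fun j _ => hX.mul_overlap_le hY hpq i j
  have h3 : ∀ i ∈ Finset.univ, ∑ j, s i ^ p / p * overlap U V W Q i j ≤ s i ^ p / p := by
    intro i _
    rw [← Finset.mul_sum]
    exact mul_le_of_le_one_right (hX.rpow_div_nonneg hpq.pos i) (sum_overlap_right_le_one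
      hX.left_orthonormal hX.right_orthonormal hY.left_orthonormal hY.right_orthonormal i)
  have h4 : ∀ j ∈ Finset.univ, ∑ i, t j ^ q / q * overlap U V W Q i j ≤ t j ^ q / q := by
    intro j _
    rw [← Finset.mul_sum]
    exact mul_le_of_le_one_right (hY.rpow_div_nonneg hpq.symm.pos j) (sum_overlap_left_le_one
      hX.left_orthonormal hX.right_orthonormal hY.left_orthonormal hY.right_orthonormal j)
  have e1 := Finset.sum_le_sum h1
  have e2 := Finset.sum_le_sum h2
  have e3 := Finset.sum_le_sum h3
  have e4 := Finset.sum_le_sum h4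
  have e5 : ∑ i, ∑ j, (s i ^ p / p + t j ^ q / q) * overlap U V W Q i j =
      (∑ i, ∑ j, s i ^ p / p * overlap U V W Q i j) +
        ∑ j, ∑ i, t j ^ q / q * overlap U V W Q i j := by
    rw [Finset.sum_comm (f := fun j i => t j ^ q / q * overlap U V W Q i j)]
    simp only [add_mul, Finset.sum_add_distrib]
  refine ⟨fun i j => ?_, fun i j hij => ?_, fun i hi => ?_, fun j hj => ?_⟩
  · have := (Finset.sum_eq_sum_iff_of_le h1).mp (by linarith) i (Finset.mem_univ _)
    exact (Finset.sum_eq_sum_iff_of_le fun j _ => hX.term_le_overlap hY i j).mp this j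
      (Finset.mem_univ _)
  · have := (Finset.sum_eq_sum_iff_of_le h2).mp (by linarith) i (Finset.mem_univ _)
    have := (Finset.sum_eq_sum_iff_of_le fun j _ => hX.mul_overlap_le hY hpq i j).mp this j
      (Finset.mem_univ _)
    exact (Real.young_inequality_eq_iff_of_nonneg (hX.nonneg i) (hY.nonneg j) hpq).mp
      (mul_right_cancel₀ hij this)
  · have := (Finset.sum_eq_sum_iff_of_le h3).mp (by linarith) i (Finset.mem_univ _)
    rw [← Finset.mul_sum] at this
    have hne : s i ^ p / p ≠ 0 := div_ne_zero
      (Real.rpow_pos_of_pos ((hX.nonneg i).lt_of_ne' hi) _).ne' hpq.ne_zero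
    exact mul_left_cancel₀ hne (this.trans (mul_one _).symm)
  · have := (Finset.sum_eq_sum_iff_of_le h4).mp (by linarith) j (Finset.mem_univ _)
    rw [← Finset.mul_sum] at this
    have hne : t j ^ q / q ≠ 0 := div_ne_zero
      (Real.rpow_pos_of_pos ((hY.nonneg j).lt_of_ne' hj) _).ne' hpq.symm.ne_zero
    exact mul_left_cancel₀ hne (this.trans (mul_one _).symm)

/-- The trace pairing of two matrices with the same singular vectors. -/
theorem re_trace_map (hX : IsSVD X U s V) {r : ι → ℝ} (hY : IsSVD Y U r V) :
    (Yᴴ * X).trace.re = ∑ i, s i * r i := by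
  rw [hX.re_trace_eq hY, hX.left_orthonormal, hX.right_orthonormal]
  refine Finset.sum_congr rfl fun i _ => ?_
  rw [Finset.sum_eq_single i]
  · simp
  · intro j _ hj
    simp [Matrix.one_apply_ne hj]
  · simp

theorem re_trace_self (hX : IsSVD X U s V) : (Xᴴ * X).trace.re = ∑ i, s i ^ 2 := by
  simp only [hX.re_trace_map hX, sq]

/-- The singular values may be replaced by other nonnegative numbers. -/
theorem map (hX : IsSVD X U s V) {r : ι → ℝ} (hr : ∀ i, 0 ≤ r i) :
    IsSVD (U * Matrix.diagonal (fun i => (r i : ℂ)) * Vᴴ) U r V :=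
  ⟨hX.left_orthonormal, hX.right_orthonormal, hr, rfl⟩

/-- Only one matrix attains equality in `IsSVD.re_trace_le` for a given `X`: writing `Z` for the
right-hand side, the equality conditions give `tr (Yᴴ Z) = tr (Zᴴ Z) = tr (Yᴴ Y)`, so that the
Frobenius norm of `Y - Z` vanishes. -/
theorem eq_of_re_trace_eq (hX : IsSVD X U s V) (hY : IsSVD Y W t Q)
    (hpq : p.HolderConjugate q)
    (h : (Yᴴ * X).trace.re = (∑ i, s i ^ p) / p + (∑ j, t j ^ q) / q) :
    Y = U * Matrix.diagonal (fun i => ((s i ^ (p - 1) : ℝ) : ℂ)) * Vᴴ := by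
  obtain ⟨h1, h2, h3, h4⟩ := hX.overlap_of_re_trace_eq hY hpq h
  set Z := U * Matrix.diagonal (fun i => ((s i ^ (p - 1) : ℝ) : ℂ)) * Vᴴ with hZ
  have hZs : IsSVD Z U (fun i => s i ^ (p - 1)) V :=
    hX.map fun i => Real.rpow_nonneg (hX.nonneg i) _
  have hp1 : p - 1 ≠ 0 := hpq.sub_one_ne_zero
  -- on the support of the overlap, the singular values of `Y` are those of `Z`
  have h5 : ∀ i j, s i ^ (p - 1) * overlap U V W Q i j = t j * overlap U V W Q i j := by
    intro i j
    by_cases hij : overlap U V W Q i j = 0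
    · rw [hij, mul_zero, mul_zero]
    · congr 1
      have e : p - 1 = p * (1 / q) := by
        have := hpq.sub_one_mul_conj
        have := hpq.symm.ne_zero
        field_simp; linarith
      rw [e, Real.rpow_mul (hX.nonneg i), h2 i j hij, ← Real.rpow_mul (hY.nonneg j),
        mul_one_div_cancel hpq.symm.ne_zero, Real.rpow_one]
  have h6 : ∀ i j, s i ^ (p - 1) * t j * ((Wᴴ * U) j i * (Vᴴ * Q) i j).re =
      s i ^ (p - 1) * t j * overlap U V W Q i j := by
    intro i j
    rcases eq_or_ne (s i) 0 with hi | hi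
    · rw [hi, Real.zero_rpow hp1]; ring
    · have := h1 i j
      rw [mul_assoc, mul_assoc] at this ⊢
      rw [mul_left_cancel₀ hi this]
  have eYZ : (Yᴴ * Z).trace.re = ∑ i, ∑ j, s i ^ (p - 1) * t j * overlap U V W Q i j := by
    rw [hZs.re_trace_eq hY]
    exact Finset.sum_congr rfl fun i _ => Finset.sum_congr rfl fun j _ => h6 i j
  have eZZ : (Yᴴ * Z).trace.re = (Zᴴ * Z).trace.re := by
    rw [eYZ, hZs.re_trace_self]
    refine Finset.sum_congr rfl fun i _ => ?_
    have : ∀ j, s i ^ (p - 1) * t j * overlap U V W Q i j =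
        (s i ^ (p - 1)) ^ 2 * overlap U V W Q i j := fun j => by
      rw [mul_assoc, ← h5 i j]; ring
    rw [Finset.sum_congr rfl fun j _ => this j, ← Finset.mul_sum]
    rcases eq_or_ne (s i) 0 with hi | hi
    · rw [hi, Real.zero_rpow hp1]; ring
    · rw [h3 i hi, mul_one]
  have eYY : (Yᴴ * Z).trace.re = (Yᴴ * Y).trace.re := by
    rw [eYZ, hY.re_trace_self, Finset.sum_comm]
    refine Finset.sum_congr rfl fun j _ => ?_
    have : ∀ i, s i ^ (p - 1) * t j * overlap U V W Q i j =
        t j ^ 2 * overlap U V W Q i j := fun i => by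
      rw [mul_right_comm, h5 i j]; ring
    rw [Finset.sum_congr rfl fun i _ => this i, ← Finset.mul_sum]
    rcases eq_or_ne (t j) 0 with hj | hj
    · rw [hj]; ring
    · rw [h4 j hj, mul_one]
  have eZY : (Zᴴ * Y).trace.re = (Yᴴ * Z).trace.re := by
    rw [← Matrix.conjTranspose_conjTranspose Y, ← Matrix.conjTranspose_mul,
      Matrix.trace_conjTranspose, Matrix.conjTranspose_conjTranspose]
    simp
  have h0 : ((Y - Z)ᴴ * (Y - Z)).trace = 0 := by
    have him := (Complex.nonneg_iff.mp
      (Matrix.posSemidef_conjTranspose_mul_self (Y - Z)).trace_nonneg).2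
    refine Complex.ext ?_ him.symm
    simp only [Matrix.conjTranspose_sub, Matrix.sub_mul, Matrix.mul_sub, Matrix.trace_sub,
      Complex.sub_re, Complex.zero_re]
    linarith
  exact sub_eq_zero.mp (Matrix.trace_conjTranspose_mul_self_eq_zero_iff.mp h0)

end IsSVD

namespace IsSVD

variable {m n : ℕ} {ι κ : Type*} [Fintype ι] [DecidableEq ι] [Fintype κ] [DecidableEq κ]
  {X Y : Matrix (Fin m) (Fin n) ℂ} {U : Matrix (Fin m) ι ℂ} {V : Matrix (Fin n) ι ℂ}
  {W : Matrix (Fin m) κ ℂ} {Q : Matrix (Fin n) κ ℂ} {s : ι → ℝ} {t : κ → ℝ}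
  {p q : ℝ}

theorem mul_rpow_sub_one (hX : IsSVD X U s V) (hpq : p.HolderConjugate q) (i : ι) :
    s i * s i ^ (p - 1) = s i ^ p := by
  rw [mul_comm, ← Real.rpow_add_one' (hX.nonneg i) (by simpa using hpq.ne_zero), sub_add_cancel]

theorem rpow_sub_one_rpow (hX : IsSVD X U s V) (hpq : p.HolderConjugate q) (i : ι) :
    (s i ^ (p - 1)) ^ q = s i ^ p := by
  rw [← Real.rpow_mul (hX.nonneg i), hpq.sub_one_mul_conj]

/-- Two decompositions of one matrix have the same power sums of singular values. The inequality
is `IsSVD.re_trace_le` for the first decomposition, paired with the matrix that attains equality for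
the second. -/
theorem sum_rpow_le (hX : IsSVD X U s V) (hX' : IsSVD X W t Q) (hpq : p.HolderConjugate q) :
    ∑ j, t j ^ p ≤ ∑ i, s i ^ p := by
  have hZ := hX'.map (r := fun j => t j ^ (p - 1)) fun j => Real.rpow_nonneg (hX'.nonneg j) _
  have h1 := hX'.re_trace_map hZ
  have h2 := hX.re_trace_le hZ hpq
  rw [h1] at h2
  simp only [hX'.mul_rpow_sub_one hpq, hX'.rpow_sub_one_rpow hpq] at h2
  have h3 := hpq.inv_add_inv_eq_one
  have h4 : (∑ j, t j ^ p) / p ≤ (∑ i, s i ^ p) / p := by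
    have : ∑ j, t j ^ p = (∑ j, t j ^ p) / p + (∑ j, t j ^ p) / q := by
      rw [div_eq_mul_inv, div_eq_mul_inv, ← mul_add, h3, mul_one]
    linarith
  exact (div_le_div_iff_of_pos_right hpq.pos).mp h4

theorem sum_rpow_eq (hX : IsSVD X U s V) (hX' : IsSVD X W t Q) (hp : 1 < p) :
    ∑ j, t j ^ p = ∑ i, s i ^ p :=
  have hpq := Real.HolderConjugate.conjExponent hp
  le_antisymm (hX.sum_rpow_le hX' hpq) (hX'.sum_rpow_le hX hpq)

end IsSVD

/-! ### Singular value decompositions and the Schatten norm -/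

/-- The columns of `V` form an eigenbasis of `Xᴴ * X`. -/
theorem exists_unitary_conjTranspose_mul_eq_diagonal {m n : ℕ} (X : Matrix (Fin m) (Fin n) ℂ) :
    ∃ V : Matrix (Fin n) (Fin n) ℂ, Vᴴ * V = 1 ∧ (X * V)ᴴ * (X * V) =
      Matrix.diagonal fun i : Fin n =>
        (((Matrix.toEuclideanLin X).singularValues i ^ 2 : ℝ) : ℂ) := by
  set T := Matrix.toEuclideanLin X with hT
  have hn : Module.finrank ℂ (EuclideanSpace ℂ (Fin n)) = n := finrank_euclideanSpace_fin
  set v := T.isSymmetric_adjoint_comp_self.eigenvectorBasis hn with hv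
  have hin : ∀ {k : ℕ} (x y : EuclideanSpace ℂ (Fin k)),
      inner ℂ x y = ∑ a, star (x a) * y a := fun x y => by
    rw [PiLp.inner_apply]
    exact Finset.sum_congr rfl fun a _ => by simp [mul_comm]
  refine ⟨Matrix.of fun b i => v i b, ?_, ?_⟩
  · ext i j
    rw [Matrix.mul_apply, Matrix.one_apply, ← orthonormal_iff_ite.mp v.orthonormal i j, hin]
    rfl
  · have hcol : ∀ a i, (X * Matrix.of fun b i => v i b) a i = T (v i) a := fun a i => by
      rw [hT, Matrix.toLpLin_apply]
      rfl
    ext i j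
    have h1 : inner ℂ (T (v i)) (T (v j)) =
        if i = j then ((T.singularValues i ^ 2 : ℝ) : ℂ) else 0 := by
      rw [← LinearMap.adjoint_inner_left, ← LinearMap.comp_apply,
        T.isSymmetric_adjoint_comp_self.apply_eigenvectorBasis hn i, inner_smul_left,
        orthonormal_iff_ite.mp v.orthonormal i j, T.sq_singularValues_fin hn]
      split_ifs <;> simp
    rw [Matrix.mul_apply, Matrix.diagonal_apply, ← h1, hin]
    refine Finset.sum_congr rfl fun a _ => ?_
    rw [Matrix.conjTranspose_apply, hcol, hcol]

theorem sum_subtype_of_eq_zero {ι M : Type*} [Fintype ι] [AddCommMonoid M] (P : ι → Prop)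
    [DecidablePred P] (f : ι → M) (hf : ∀ i, ¬ P i → f i = 0) :
    ∑ i : {i // P i}, f i = ∑ i, f i := by
  rw [← Fintype.sum_subtype_add_sum_subtype P f,
    Finset.sum_eq_zero (f := fun i : {i // ¬ P i} => f i) fun i _ => hf i.1 i.2, add_zero]

/-- A singular value decomposition over the nonzero singular values. Dropping the zeros is what
allows the left singular vectors to be defined as `X vᵢ / sᵢ`. -/
theorem exists_isSVD {m n : ℕ} (X : Matrix (Fin m) (Fin n) ℂ) :
    ∃ (U : Matrix (Fin m) {i : Fin n // (Matrix.toEuclideanLin X).singularValues i ≠ 0} ℂ)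
      (V : Matrix (Fin n) {i : Fin n // (Matrix.toEuclideanLin X).singularValues i ≠ 0} ℂ),
      IsSVD X U (fun i => (Matrix.toEuclideanLin X).singularValues i.1) V := by
  obtain ⟨V, hV, hXV⟩ := exists_unitary_conjTranspose_mul_eq_diagonal X
  set σ := (Matrix.toEuclideanLin X).singularValues
  have hent : ∀ i j, ∑ a, star ((X * V) a i) * (X * V) a j =
      if i = j then ((σ i ^ 2 : ℝ) : ℂ) else 0 := fun i j => by
    rw [← Matrix.diagonal_apply (d := fun i : Fin n => ((σ i ^ 2 : ℝ) : ℂ)), ← hXV,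
      Matrix.mul_apply]
    rfl
  have hzero : ∀ i : Fin n, σ i = 0 → ∀ a, (X * V) a i = 0 := by
    intro i hi
    have h := hent i i
    rw [if_pos rfl, hi] at h
    have h' : star ((X * V).col i) ⬝ᵥ ((X * V).col i) = 0 := h.trans (by simp)
    exact fun a => congrFun (dotProduct_star_self_eq_zero.mp (by rwa [dotProduct_comm] at h')) a
  refine ⟨Matrix.of fun a i => (X * V) a i.1 / (σ i.1 : ℂ), V.submatrix id Subtype.val,
    ?_, ?_, fun i => LinearMap.singularValues_nonneg _ _, ?_⟩
  · ext i j
    have hi : (σ i.1 : ℂ) ≠ 0 := Complex.ofReal_ne_zero.mpr i.2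
    have hj : (σ j.1 : ℂ) ≠ 0 := Complex.ofReal_ne_zero.mpr j.2
    have h1 : ∀ a, star ((X * V) a i.1 / (σ i.1 : ℂ)) * ((X * V) a j.1 / (σ j.1 : ℂ)) =
        star ((X * V) a i.1) * (X * V) a j.1 * ((σ i.1 : ℂ) * (σ j.1 : ℂ))⁻¹ := fun a => by
      rw [star_div₀, show star (σ i.1 : ℂ) = (σ i.1 : ℂ) from Complex.conj_ofReal _]
      field_simp
    rw [Matrix.mul_apply]
    simp only [Matrix.conjTranspose_apply, Matrix.of_apply, h1, ← Finset.sum_mul, hent]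
    rw [Matrix.one_apply]
    by_cases hij : i = j
    · subst hij
      simp only [if_true]
      push_cast
      field_simp
    · rw [if_neg hij, if_neg (fun h => hij (Subtype.ext h)), zero_mul]
  · rw [Matrix.conjTranspose_submatrix, ← Matrix.submatrix_mul _ _ _ id _ Function.bijective_id,
      hV, Matrix.submatrix_one _ Subtype.val_injective]
  · have h1 : X = X * V * Vᴴ := by
      rw [Matrix.mul_assoc, mul_eq_one_comm.mp hV, Matrix.mul_one]
    conv_lhs => rw [h1]
    ext a b
    rw [Matrix.mul_apply, Matrix.mul_apply,
      ← sum_subtype_of_eq_zero (fun i : Fin n => σ i ≠ 0) (fun i => (X * V) a i * Vᴴ i b)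
        fun i hi => by rw [hzero i (not_not.mp hi), zero_mul]]
    refine Finset.sum_congr rfl fun i _ => ?_
    have hi : (σ i.1 : ℂ) ≠ 0 := Complex.ofReal_ne_zero.mpr i.2
    rw [Matrix.mul_diagonal, Matrix.of_apply, div_mul_cancel₀ _ hi]
    rfl

theorem schattenNorm_nonneg {m n : ℕ} (p : ℝ) (X : Matrix (Fin m) (Fin n) ℂ) :
    0 ≤ schattenNorm p X :=
  Real.rpow_nonneg (Finset.sum_nonneg fun _ _ =>
    Real.rpow_nonneg (LinearMap.singularValues_nonneg _ _) _) _

theorem schattenNorm_rpow_self {m n : ℕ} {p : ℝ} (hp : 1 < p) (X : Matrix (Fin m) (Fin n) ℂ) :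
    schattenNorm p X ^ p =
      ∑ i : Fin n, (Matrix.toEuclideanLin X).singularValues i ^ p := by
  rw [schattenNorm, ← Real.rpow_mul (Finset.sum_nonneg fun _ _ =>
    Real.rpow_nonneg (LinearMap.singularValues_nonneg _ _) _),
    one_div_mul_cancel (by linarith), Real.rpow_one]

/-- The Schatten norm can be computed from any singular value decomposition. -/
theorem IsSVD.schattenNorm_rpow {m n : ℕ} {ι : Type*} [Fintype ι] [DecidableEq ι]
    {X : Matrix (Fin m) (Fin n) ℂ} {U : Matrix (Fin m) ι ℂ} {s : ι → ℝ}
    {V : Matrix (Fin n) ι ℂ} {p : ℝ} (hp : 1 < p) (hX : IsSVD X U s V) :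
    schattenNorm p X ^ p = ∑ i, s i ^ p := by
  obtain ⟨U', V', h⟩ := exists_isSVD X
  rw [schattenNorm_rpow_self hp, h.sum_rpow_eq hX hp]
  exact (sum_subtype_of_eq_zero _
    (fun i : Fin n => (Matrix.toEuclideanLin X).singularValues i ^ p) fun i hi => by
      rw [not_not.mp hi, Real.zero_rpow (by linarith)]).symm

theorem IsSVD.schattenNorm_eq {m n : ℕ} {ι : Type*} [Fintype ι] [DecidableEq ι]
    {X : Matrix (Fin m) (Fin n) ℂ} {U : Matrix (Fin m) ι ℂ} {s : ι → ℝ}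
    {V : Matrix (Fin n) ι ℂ} {p : ℝ} (hp : 1 < p) (hX : IsSVD X U s V) :
    schattenNorm p X = (∑ i, s i ^ p) ^ (1 / p) := by
  rw [← hX.schattenNorm_rpow hp, ← Real.rpow_mul (schattenNorm_nonneg p X),
    mul_one_div_cancel (by linarith), Real.rpow_one]

/-! ### Hölder's inequality and norming functionals -/

section schatten

variable {m n : ℕ} {p q : ℝ}

theorem schattenNorm_eq_of_rpow_eq (hp : 0 < p) {X : Matrix (Fin m) (Fin n) ℂ} {r : ℝ} (hr : 0 ≤ r)
    (h : schattenNorm p X ^ p = r ^ p) : schattenNorm p X = r :=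
  (Real.rpow_left_inj (schattenNorm_nonneg p X) hr hp.ne').mp h

theorem schattenNorm_smul (hp : 1 < p) (c : ℂ) (X : Matrix (Fin m) (Fin n) ℂ) :
    schattenNorm p (c • X) = ‖c‖ * schattenNorm p X := by
  obtain ⟨U, V, hX⟩ := exists_isSVD X
  -- the phase of `c` is absorbed into the left singular vectors
  obtain ⟨w, hw, hc⟩ : ∃ w : ℂ, star w * w = 1 ∧ c = ‖c‖ * w := by
    rcases eq_or_ne c 0 with rfl | h
    · exact ⟨1, by simp⟩
    · have h' : (‖c‖ : ℂ) ≠ 0 := by simpa using h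
      refine ⟨c / ‖c‖, ?_, by field_simp⟩
      have : star (c / (‖c‖ : ℂ)) * (c / ‖c‖) = ((‖c / (‖c‖ : ℂ)‖ : ℝ) : ℂ) ^ 2 :=
        Complex.conj_mul' _
      rw [this]
      simp [h]
  have hcX : IsSVD (c • X) (w • U)
      (fun i => ‖c‖ * (Matrix.toEuclideanLin X).singularValues i.1) V := by
    refine ⟨?_, hX.right_orthonormal, fun i => mul_nonneg (norm_nonneg _) (hX.nonneg i), ?_⟩
    · rw [Matrix.conjTranspose_smul, Matrix.smul_mul, Matrix.mul_smul, smul_smul, hw, one_smul,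
        hX.left_orthonormal]
    · conv_lhs => rw [hX.eq, hc]
      have : (Matrix.diagonal fun i : {i : Fin n // (Matrix.toEuclideanLin X).singularValues i ≠ 0}
          => ((‖c‖ * (Matrix.toEuclideanLin X).singularValues i.1 : ℝ) : ℂ)) = (‖c‖ : ℂ) •
            Matrix.diagonal fun i => ((Matrix.toEuclideanLin X).singularValues i.1 : ℂ) := by
        rw [← Matrix.diagonal_smul]
        congr 1
        ext i
        simp
      rw [this]
      simp only [Matrix.smul_mul, Matrix.mul_smul, smul_smul]
  refine schattenNorm_eq_of_rpow_eq (by linarith)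
    (mul_nonneg (norm_nonneg _) (schattenNorm_nonneg p X)) ?_
  rw [hcX.schattenNorm_rpow hp, Real.mul_rpow (norm_nonneg _) (schattenNorm_nonneg p X),
    hX.schattenNorm_rpow hp, Finset.mul_sum]
  exact Finset.sum_congr rfl fun i _ => Real.mul_rpow (norm_nonneg _) (hX.nonneg i)

theorem schattenNorm_zero (hp : 1 < p) : schattenNorm p (0 : Matrix (Fin m) (Fin n) ℂ) = 0 := by
  simpa using schattenNorm_smul hp 0 (0 : Matrix (Fin m) (Fin n) ℂ)

theorem eq_zero_of_schattenNorm_eq_zero (hp : 1 < p) {X : Matrix (Fin m) (Fin n) ℂ}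
    (h : schattenNorm p X = 0) : X = 0 := by
  obtain ⟨U, V, hX⟩ := exists_isSVD X
  have h1 := hX.schattenNorm_rpow hp
  rw [h, Real.zero_rpow (by linarith)] at h1
  have h2 := (Finset.sum_eq_zero_iff_of_nonneg fun i _ =>
    Real.rpow_nonneg (hX.nonneg i) p).mp h1.symm
  have h3 : ∀ i : {i : Fin n // (Matrix.toEuclideanLin X).singularValues i ≠ 0},
      (Matrix.toEuclideanLin X).singularValues i.1 = 0 := fun i =>
    ((Real.rpow_eq_zero (hX.nonneg i) (by linarith)).mp (h2 i (Finset.mem_univ i)))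
  rw [hX.eq]
  simp [h3]

theorem re_trace_le_schattenNorm_rpow (hpq : p.HolderConjugate q)
    (X Y : Matrix (Fin m) (Fin n) ℂ) :
    (Yᴴ * X).trace.re ≤ schattenNorm p X ^ p / p + schattenNorm q Y ^ q / q := by
  obtain ⟨U, V, hX⟩ := exists_isSVD X
  obtain ⟨W, Q, hY⟩ := exists_isSVD Y
  rw [hX.schattenNorm_rpow hpq.lt, hY.schattenNorm_rpow hpq.symm.lt]
  exact hX.re_trace_le hY hpq

/-- Hölder's inequality for Schatten norms, from Young's inequality for the normalized matrices. -/
theorem re_trace_le_schattenNorm_mul (hpq : p.HolderConjugate q)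
    (X Y : Matrix (Fin m) (Fin n) ℂ) :
    (Yᴴ * X).trace.re ≤ schattenNorm q Y * schattenNorm p X := by
  rcases (schattenNorm_nonneg p X).eq_or_lt with hX | hX
  · rw [← hX, eq_zero_of_schattenNorm_eq_zero hpq.lt hX.symm]
    simp
  rcases (schattenNorm_nonneg q Y).eq_or_lt with hY | hY
  · rw [← hY, eq_zero_of_schattenNorm_eq_zero hpq.symm.lt hY.symm]
    simp
  set x := schattenNorm p X
  set y := schattenNorm q Y
  have h := re_trace_le_schattenNorm_rpow hpq (((x⁻¹ : ℝ) : ℂ) • X) (((y⁻¹ : ℝ) : ℂ) • Y)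
  rw [schattenNorm_smul hpq.lt, schattenNorm_smul hpq.symm.lt, Complex.norm_real, Complex.norm_real,
    Real.norm_of_nonneg (inv_nonneg.mpr hX.le), Real.norm_of_nonneg (inv_nonneg.mpr hY.le),
    inv_mul_cancel₀ hX.ne', inv_mul_cancel₀ hY.ne', Real.one_rpow, Real.one_rpow, one_div, one_div,
    hpq.inv_add_inv_eq_one, Matrix.conjTranspose_smul, Matrix.smul_mul, Matrix.mul_smul, smul_smul,
    Matrix.trace_smul, smul_eq_mul, show star ((y⁻¹ : ℝ) : ℂ) = ((y⁻¹ : ℝ) : ℂ) from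
      Complex.conj_ofReal _, ← Complex.ofReal_mul, Complex.re_ofReal_mul, ← mul_inv,
    inv_mul_le_iff₀ (mul_pos hY hX), mul_one] at h
  exact h

/-- The modulus version of `re_trace_le_schattenNorm_mul`, by a rotation of `X`. -/
theorem norm_trace_le_schattenNorm_mul (hpq : p.HolderConjugate q)
    (X Y : Matrix (Fin m) (Fin n) ℂ) :
    ‖(Yᴴ * X).trace‖ ≤ schattenNorm q Y * schattenNorm p X := by
  obtain ⟨c, hc, h⟩ : ∃ c : ℂ, ‖c‖ = 1 ∧ ((‖(Yᴴ * X).trace‖ : ℝ) : ℂ) = c * (Yᴴ * X).trace :=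
    RCLike.exists_norm_eq_mul_self _
  have h1 := re_trace_le_schattenNorm_mul hpq (c • X) Y
  rw [schattenNorm_smul hpq.lt, hc, one_mul, Matrix.mul_smul, Matrix.trace_smul, smul_eq_mul, ← h,
    Complex.ofReal_re] at h1
  exact h1

/-- `Y` represents a norming functional of `X` through the trace pairing: it attains equality in
Hölder's inequality for `X`. The normalization `‖Y‖_q ^ q = ‖X‖_p ^ p`, which makes the pairing equal
to `‖X‖_p ^ p`, also makes Young's inequality an equality. If `X = U * diagonal s * Vᴴ`, then
`Y = U * diagonal (s ^ (p - 1)) * Vᴴ`. -/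
structure IsDual (p q : ℝ) (X Y : Matrix (Fin m) (Fin n) ℂ) : Prop where
  schattenNorm_rpow : schattenNorm q Y ^ q = schattenNorm p X ^ p
  re_trace : (Yᴴ * X).trace.re = schattenNorm p X ^ p

theorem IsSVD.isDual {ι : Type*} [Fintype ι] [DecidableEq ι]
    {X : Matrix (Fin m) (Fin n) ℂ} {U : Matrix (Fin m) ι ℂ} {s : ι → ℝ}
    {V : Matrix (Fin n) ι ℂ} (hX : IsSVD X U s V) (hpq : p.HolderConjugate q) :
    IsDual p q X (U * Matrix.diagonal (fun i => ((s i ^ (p - 1) : ℝ) : ℂ)) * Vᴴ) := by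
  have hZ := hX.map (r := fun j => s j ^ (p - 1)) fun j => Real.rpow_nonneg (hX.nonneg j) _
  refine ⟨?_, ?_⟩
  · rw [hZ.schattenNorm_rpow hpq.symm.lt, hX.schattenNorm_rpow hpq.lt]
    exact Finset.sum_congr rfl fun i _ => hX.rpow_sub_one_rpow hpq i
  · rw [hX.re_trace_map hZ, hX.schattenNorm_rpow hpq.lt]
    exact Finset.sum_congr rfl fun i _ => hX.mul_rpow_sub_one hpq i

theorem exists_isDual (hpq : p.HolderConjugate q) (X : Matrix (Fin m) (Fin n) ℂ) :
    ∃ Y, IsDual p q X Y :=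
  let ⟨_, _, hX⟩ := exists_isSVD X
  ⟨_, hX.isDual hpq⟩

namespace IsDual

variable {X Y Y' : Matrix (Fin m) (Fin n) ℂ}

theorem eq_of_isSVD {ι : Type*} [Fintype ι] [DecidableEq ι] {U : Matrix (Fin m) ι ℂ} {s : ι → ℝ}
    {V : Matrix (Fin n) ι ℂ} (h : IsDual p q X Y) (hX : IsSVD X U s V)
    (hpq : p.HolderConjugate q) :
    Y = U * Matrix.diagonal (fun i => ((s i ^ (p - 1) : ℝ) : ℂ)) * Vᴴ := by
  obtain ⟨W, Q, hY⟩ := exists_isSVD Y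
  refine hX.eq_of_re_trace_eq hY hpq ?_
  rw [h.re_trace, ← hX.schattenNorm_rpow hpq.lt, ← hY.schattenNorm_rpow hpq.symm.lt,
    h.schattenNorm_rpow, div_eq_mul_inv, div_eq_mul_inv, ← mul_add, hpq.inv_add_inv_eq_one,
    mul_one]

/-- Smoothness of the Schatten norm: a matrix has only one norming functional. -/
theorem unique (hpq : p.HolderConjugate q) (h : IsDual p q X Y) (h' : IsDual p q X Y') :
    Y = Y' := by
  obtain ⟨U, V, hX⟩ := exists_isSVD X
  exact (h.eq_of_isSVD hX hpq).trans (h'.eq_of_isSVD hX hpq).symm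

theorem schattenNorm_eq (hpq : p.HolderConjugate q) (h : IsDual p q X Y) :
    schattenNorm q Y = schattenNorm p X ^ (p - 1) := by
  refine schattenNorm_eq_of_rpow_eq hpq.symm.pos (Real.rpow_nonneg (schattenNorm_nonneg p X) _) ?_
  rw [h.schattenNorm_rpow, ← Real.rpow_mul (schattenNorm_nonneg p X), hpq.sub_one_mul_conj]

end IsDual

theorem schattenNorm_rpow_sub_one_mul (hp : 1 < p) (X : Matrix (Fin m) (Fin n) ℂ) :
    schattenNorm p X ^ (p - 1) * schattenNorm p X = schattenNorm p X ^ p := by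
  rw [← Real.rpow_add_one' (schattenNorm_nonneg p X) (by linarith), sub_add_cancel]

/-- Minkowski's inequality for the Schatten norm, from a norming functional of `X + Y`. -/
theorem schattenNorm_add_le (hp : 1 < p) (X Y : Matrix (Fin m) (Fin n) ℂ) :
    schattenNorm p (X + Y) ≤ schattenNorm p X + schattenNorm p Y := by
  have hpq := Real.HolderConjugate.conjExponent hp
  obtain ⟨Z, hZ⟩ := exists_isDual hpq (X + Y)
  rcases (schattenNorm_nonneg p (X + Y)).eq_or_lt with h0 | h0
  · rw [← h0]
    exact add_nonneg (schattenNorm_nonneg p X) (schattenNorm_nonneg p Y)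
  have h1 := hZ.re_trace
  rw [Matrix.mul_add, Matrix.trace_add, Complex.add_re, ← schattenNorm_rpow_sub_one_mul hp] at h1
  have h2 := re_trace_le_schattenNorm_mul hpq X Z
  have h3 := re_trace_le_schattenNorm_mul hpq Y Z
  rw [hZ.schattenNorm_eq hpq] at h2 h3
  have h4 := Real.rpow_pos_of_pos h0 (p - 1)
  refine le_of_mul_le_mul_left ?_ h4
  rw [mul_add]
  linarith

/-- If the triangle inequality is an equality, then a norming functional of `X + Y` norms both `X`
and `Y`; by uniqueness it is a multiple of the norming functional `Z` of `X`, which thus norms `Y`. -/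
theorem IsDual.re_trace_of_schattenNorm_add_eq (hpq : p.HolderConjugate q)
    {X Y Z : Matrix (Fin m) (Fin n) ℂ} (hZ : IsDual p q X Z) (hX : X ≠ 0)
    (h : schattenNorm p (X + Y) = schattenNorm p X + schattenNorm p Y) :
    (Zᴴ * Y).trace.re = schattenNorm q Z * schattenNorm p Y := by
  have hp := hpq.lt
  obtain ⟨F, hF⟩ := exists_isDual hpq (X + Y)
  have hx : 0 < schattenNorm p X := (schattenNorm_nonneg p X).lt_of_ne' fun h0 =>
    hX (eq_zero_of_schattenNorm_eq_zero hp h0)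
  have hy := schattenNorm_nonneg p Y
  have h1 := hF.re_trace
  have hFq := hF.schattenNorm_eq hpq
  rw [Matrix.mul_add, Matrix.trace_add, Complex.add_re, ← schattenNorm_rpow_sub_one_mul hp] at h1
  have h2 := re_trace_le_schattenNorm_mul hpq X F
  have h3 := re_trace_le_schattenNorm_mul hpq Y F
  rw [hFq] at h2 h3
  rw [h] at h1 h2 h3 hFq
  set x := schattenNorm p X
  set y := schattenNorm p Y
  have hN : 0 < x + y := by linarith
  have hNp := Real.rpow_pos_of_pos hN (p - 1)
  have e2 : (Fᴴ * X).trace.re = (x + y) ^ (p - 1) * x := by linarith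
  have e3 : (Fᴴ * Y).trace.re = (x + y) ^ (p - 1) * y := by linarith
  -- `r • F` is the normalization of `F` as a norming functional of `X`
  set r : ℝ := x ^ (p - 1) / (x + y) ^ (p - 1) with hr
  have hr0 : 0 ≤ r := div_nonneg (Real.rpow_nonneg hx.le _) hNp.le
  have hrtr : ∀ M : Matrix (Fin m) (Fin n) ℂ,
      (((r : ℂ) • F)ᴴ * M).trace.re = r * (Fᴴ * M).trace.re := fun M => by
    rw [Matrix.conjTranspose_smul, Matrix.smul_mul, Matrix.trace_smul, smul_eq_mul,
      show star (r : ℂ) = (r : ℂ) from Complex.conj_ofReal _, Complex.re_ofReal_mul]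
  have hFX : IsDual p q X ((r : ℂ) • F) := by
    refine ⟨?_, ?_⟩
    · rw [schattenNorm_smul hpq.symm.lt, Complex.norm_real, Real.norm_of_nonneg hr0, hFq, hr,
        div_mul_cancel₀ _ hNp.ne', ← Real.rpow_mul hx.le, hpq.sub_one_mul_conj]
    · rw [hrtr, e2, ← mul_assoc, hr, div_mul_cancel₀ _ hNp.ne']
      exact schattenNorm_rpow_sub_one_mul hp X
  rw [hZ.schattenNorm_eq hpq, hZ.unique hpq hFX, hrtr, e3, ← mul_assoc, hr,
    div_mul_cancel₀ _ hNp.ne']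

/-- Norm-parallelism to `X` is tested by the norming functional of `X` alone. -/
theorem IsDual.normParallel_iff (hpq : p.HolderConjugate q)
    {X Y Z : Matrix (Fin m) (Fin n) ℂ} (hZ : IsDual p q X Z) :
    NormParallel (schattenNorm p) X Y ↔
      ‖(Zᴴ * Y).trace‖ = schattenNorm q Z * schattenNorm p Y := by
  have hp := hpq.lt
  rcases eq_or_ne X 0 with rfl | hX
  · have hZ0 : schattenNorm q Z = 0 := by
      rw [hZ.schattenNorm_eq hpq, schattenNorm_zero hp, Real.zero_rpow hpq.sub_one_ne_zero]
    rw [hZ0, eq_zero_of_schattenNorm_eq_zero hpq.symm.lt hZ0]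
    refine iff_of_true ⟨1, norm_one, ?_⟩ (by simp)
    rw [one_smul, zero_add, schattenNorm_zero hp, zero_add]
  constructor
  · rintro ⟨c, hc, h⟩
    have hcY : schattenNorm p (c • Y) = schattenNorm p Y := by
      rw [schattenNorm_smul hp, hc, one_mul]
    rw [← hcY] at h
    have h1 := hZ.re_trace_of_schattenNorm_add_eq hpq hX h
    refine le_antisymm (norm_trace_le_schattenNorm_mul hpq Y Z) ?_
    rw [hcY, Matrix.mul_smul, Matrix.trace_smul, smul_eq_mul] at h1
    rw [← h1]
    refine (Complex.re_le_norm _).trans ?_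
    rw [norm_mul, hc, one_mul]
  · intro h
    obtain ⟨c, hc, hcn⟩ : ∃ c : ℂ, ‖c‖ = 1 ∧
        ((‖(Zᴴ * Y).trace‖ : ℝ) : ℂ) = c * (Zᴴ * Y).trace := RCLike.exists_norm_eq_mul_self _
    have hcY : schattenNorm p (c • Y) = schattenNorm p Y := by
      rw [schattenNorm_smul hp, hc, one_mul]
    refine ⟨c, hc, le_antisymm (by simpa only [hcY] using schattenNorm_add_le hp X (c • Y)) ?_⟩
    have h1 := re_trace_le_schattenNorm_mul hpq (X + c • Y) Z
    rw [Matrix.mul_add, Matrix.trace_add, Complex.add_re, hZ.re_trace, Matrix.mul_smul,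
      Matrix.trace_smul, smul_eq_mul, ← hcn, Complex.ofReal_re, h,
      ← schattenNorm_rpow_sub_one_mul hp, ← hZ.schattenNorm_eq hpq, ← mul_add] at h1
    refine le_of_mul_le_mul_left h1 ?_
    rw [hZ.schattenNorm_eq hpq]
    exact Real.rpow_pos_of_pos ((schattenNorm_nonneg p X).lt_of_ne' fun h0 =>
      hX (eq_zero_of_schattenNorm_eq_zero hp h0)) _

end schatten

/-! ### Generalized polar decompositions -/

theorem rpow_eq_eigenvectorUnitary_mul {m : ℕ} {D : Matrix (Fin m) (Fin m) ℂ}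
    (hD : D.PosSemidef) (r : ℝ) :
    D ^ r = (hD.1.eigenvectorUnitary : Matrix (Fin m) (Fin m) ℂ) *
      Matrix.diagonal (fun i => ((hD.1.eigenvalues i ^ r : ℝ) : ℂ)) *
      (hD.1.eigenvectorUnitary : Matrix (Fin m) (Fin m) ℂ)ᴴ := by
  rw [CFC.rpow_eq_cfc_real (Matrix.nonneg_iff_posSemidef.mpr hD), hD.1.cfc_eq]
  rfl

theorem corollary3p4 {m n : ℕ} (p : ℝ) (hp : 1 < p)
    (A B : Matrix (Fin m) (Fin n) ℂ)
    (D : Matrix (Fin m) (Fin m) ℂ) (C : Matrix (Fin m) (Fin n) ℂ)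
    (hD : D.PosSemidef) (hC : C * Cᴴ = 1) (hA : A = D * C) :
    NormParallel (schattenNorm p) A B ↔
      ‖(D ^ (p - 1) * C * Bᴴ).trace‖ =
        schattenNorm p B * schattenNorm p D ^ p / schattenNorm p A := by
  have hpq := Real.HolderConjugate.conjExponent hp
  set q := p.conjExponent
  set E : Matrix (Fin m) (Fin m) ℂ := hD.1.eigenvectorUnitary.1 with hE
  have hEE : Eᴴ * E = 1 := Unitary.coe_star_mul_self hD.1.eigenvectorUnitary
  have hDE : D = E * Matrix.diagonal (fun i => (hD.1.eigenvalues i : ℂ)) * Eᴴ :=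
    hD.1.spectral_theorem
  have hDs : IsSVD D E hD.1.eigenvalues E := ⟨hEE, hEE, hD.eigenvalues_nonneg, hDE⟩
  -- since `C * Cᴴ = 1`, the vectors `Cᴴ e` for `e` in an eigenbasis of `D` are orthonormal
  have hAs : IsSVD A E hD.1.eigenvalues (Cᴴ * E) := by
    refine ⟨hEE, ?_, hD.eigenvalues_nonneg, ?_⟩
    · rw [Matrix.conjTranspose_mul, Matrix.conjTranspose_conjTranspose, Matrix.mul_assoc,
        ← Matrix.mul_assoc C, hC, Matrix.one_mul, hEE]
    · rw [hA, Matrix.conjTranspose_mul, Matrix.conjTranspose_conjTranspose, ← Matrix.mul_assoc,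
        ← hDE]
  have hZ : IsDual p q A (D ^ (p - 1) * C) := by
    have h := hAs.isDual hpq
    rwa [Matrix.conjTranspose_mul, Matrix.conjTranspose_conjTranspose, ← Matrix.mul_assoc,
      ← rpow_eq_eigenvectorUnitary_mul hD] at h
  have hDA : schattenNorm p D = schattenNorm p A := by
    rw [hDs.schattenNorm_eq hp, hAs.schattenNorm_eq hp]
  have htr : ‖(D ^ (p - 1) * C * Bᴴ).trace‖ = ‖((D ^ (p - 1) * C)ᴴ * B).trace‖ := by
    rw [← norm_star, ← Matrix.trace_conjTranspose, Matrix.conjTranspose_mul,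
      Matrix.conjTranspose_conjTranspose, Matrix.trace_mul_comm]
  rw [hZ.normParallel_iff hpq, htr, hZ.schattenNorm_eq hpq, hDA]
  have hr : schattenNorm p A ^ (p - 1) * schattenNorm p B =
      schattenNorm p B * schattenNorm p A ^ p / schattenNorm p A := by
    rcases eq_or_ne (schattenNorm p A) 0 with h0 | h0
    -- here the right-hand side is `0` because division by zero gives zero
    · rw [h0, Real.zero_rpow hpq.sub_one_ne_zero, zero_mul, div_zero]
    · rw [← schattenNorm_rpow_sub_one_mul hp A, ← mul_assoc, mul_div_cancel_right₀ _ h0, mul_comm]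
  rw [hr]
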